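/- **Definitions.** A *subordination* between boolean algebras $A,B$ is a relation $S\subseteq A\times B$ such that $0\,S\,0$ and $1\,S\,1$; $a,b\,S\,c$ implies $(a\vee b)\,S\,c$; $a\,S\,c,d$ implies $a\,S\,(c\wedge d)$; and $a\le b\,S\,c\le d$ implies $a\,S\,d$. An *$\mathsf{S5}$-subordination algebra* is a pair $\mathbf B=(B,S)$ with $B$ a boolean algebra and $S$ a subordination on $B$ such that $a\,S\,b$ implies $a\le b$; $a\,S\,b$ implies $\neg b\,S\,\neg a$; and $a\,S\,b$ implies $a\,S\,c\,S\,b$ for some $c\in B$. It is a *de Vries algebra* if $B$ is complete and for each $a\ne 0$ there is $b\neq 0$ with $b\,S\,a$. A subordination $T\colon (B_1,S_1)\to(B_2,S_2)$ is *compatible* if $S_2\circ T=T=T\circ S_1$. Let $\mathsf{SubS5^S}$ be the category of $\mathsf{S5}$-subordination algebras and compatible subordinations, with relation composition as composition and with $S$ as the identity on $(B,S)$. Let $\Delta\colon\mathsf{DeV^S}\hookrightarrow\mathsf{SubS5^S}$ be the inclusion of the full subcategory of de Vries algebras. In a frame $L$ let $a^*$ be the pseudocomplement of $a$, and write $a\prec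 b$ if $a^*\vee b=1$. $L$ is *compact* if $1$ is a compact element, and *regular* if $a=\bigvee\{x\mid x\prec a\}$ for all $a\in L$. A *preframe homomorphism* is a map between frames that preserves finite meets and directed joins (directed sets being nonempty). Let $\mathsf{KRFrm^P}$ be the category of compact regular frames and preframe homomorphisms. A *round ideal* of $\mathbf B=(B,S)$ is an ideal $I$ of $B$ such that each $a\in I$ satisfies $a\,S\,b$ for some $b\in I$. The contravariant functor $\mathcal{RI}\colon\mathsf{SubS5^S}\to\mathsf{KRFrm^P}$ sends $\mathbf B$ to the set of its round ideals ordered by inclusion, and $T\colon\mathbf B_1\to\mathbf B_2$ to $\mathcal{RI}(T)\colon\mathcal{RI}(\mathbf B_2)\to\mathcal{RI}(\mathbf B_1)$, $I\mapsto T^{-1}[I]=\{a\mid a\,T\,b\text{ for some }b\in I\}$. The contravariant functor $\mathfrak B\colon\mathsf{KRFrm^P}\to\mathsf{DeV^S}$ sends $L$ to $(\mathfrak BL,\prec)$, where $\mathfrak BL=\{a\in L\mid a=a^{**}\}$ is its booleanization and $\prec$ is the restriction of the relation $\prec$ of $L$, and sends $\Box\colon L\to M$ to the relation $\mathfrak B(\Box)\colon\mathfrak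 BM\to\mathfrak BL$ given by $b\mathrel{\mathfrak B(\Box)}a\iff b\prec\Box a$. Let $\mathcal{NI}=\mathfrak B\circ\mathcal{RI}\colon\mathsf{SubS5^S}\to\mathsf{DeV^S}$. **Theorem.** 1. $\mathcal{RI}$ and $\Delta\circ\mathfrak B$ form a dual equivalence between $\mathsf{SubS5^S}$ and $\mathsf{KRFrm^P}$. 2. $\mathcal{RI}\circ\Delta$ and $\mathfrak B$ form a dual equivalence between $\mathsf{DeV^S}$ and $\mathsf{KRFrm^P}$. Moreover, $\mathcal{NI}$ and $\Delta$ form an equivalence between $\mathsf{SubS5^S}$ and $\mathsf{DeV^S}$, and the resulting triangle, with sides $\mathcal{RI}\colon\mathsf{SubS5^S}\to\mathsf{KRFrm^P}$, $\mathfrak B\colon\mathsf{KRFrm^P}\to\mathsf{DeV^S}$ and the pair $\mathcal{NI}\colon\mathsf{SubS5^S}\leftrightarrows\mathsf{DeV^S}:\!\Delta$, commutes up to natural isomorphism: $\mathfrak B\circ\mathcal{RI}\cong\mathcal{NI}$, $\Delta\circ\mathfrak B\circ\mathcal{RI}\cong 1_{\mathsf{SubS5^S}}$, $\mathfrak B\circ\mathcal{RI}\circ\Delta\cong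 1_{\mathsf{DeV^S}}$, $\mathcal{RI}\circ\Delta\circ\mathfrak B\cong 1_{\mathsf{KRFrm^P}}$, $\Delta\circ\mathcal{NI}\cong 1_{\mathsf{SubS5^S}}$ and $\mathcal{NI}\circ\Delta\cong 1_{\mathsf{DeV^S}}$. -/

import Mathlib

universe u

namespace S5Sub

open CategoryTheory

/-! Subordinations and S5-subordination algebras -/

/-- A subordination between boolean algebras. -/
structure IsSubordination {A B : Type*} [BooleanAlgebra A] [BooleanAlgebra B]
    (S : A → B → Prop) : Prop where
  bot_bot : S ⊥ ⊥
  top_top : S ⊤ ⊤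
  sup_left : ∀ a b c, S a c → S b c → S (a ⊔ b) c
  inf_right : ∀ a c d, S a c → S a d → S a (c ⊓ d)
  mono : ∀ a b c d, a ≤ b → S b c → c ≤ d → S a d

/-- An S5-subordination on a boolean algebra. -/
structure IsS5Subordination {B : Type*} [BooleanAlgebra B] (S : B → B → Prop) : Prop
    extends IsSubordination S where
  le_of_rel : ∀ a b, S a b → a ≤ b
  compl_rel : ∀ a b, S a b → S bᶜ aᶜ
  exists_between : ∀ a b, S a b → ∃ c, S a c ∧ S c b

/-- S5-subordination algebras: the objects of `SubS5^S`. -/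
structure SubS5S : Type (u + 1) where
  carrier : Type u
  [boolean : BooleanAlgebra carrier]
  rel : carrier → carrier → Prop
  isS5 : IsS5Subordination rel

attribute [instance] SubS5S.boolean

/-- `T : B₁ → B₂` is a compatible subordination: `T` is a subordination and
`S₂ ∘ T = T = T ∘ S₁`. (`Relation.Comp R R'` relates `a` to `c` iff `R a b` and `R' b c`
for some `b`.) -/
structure IsCompatibleSubordination (B₁ B₂ : SubS5S.{u})
    (T : B₁.carrier → B₂.carrier → Prop) : Prop extends IsSubordination T where
  comp_right : Relation.Comp T B₂.rel = T
  comp_left : Relation.Comp B₁.rel T = T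

/-- Morphisms of `SubS5^S`: compatible subordinations. -/
@[ext]
structure SubS5S.Hom (B₁ B₂ : SubS5S.{u}) : Type u where
  rel : B₁.carrier → B₂.carrier → Prop
  compat : IsCompatibleSubordination B₁ B₂ rel

theorem SubS5S.comp_rel_self (B : SubS5S.{u}) : Relation.Comp B.rel B.rel = B.rel := by
  funext a b
  refine propext ⟨?_, fun h => B.isS5.exists_between a b h⟩
  rintro ⟨c, hac, hcb⟩
  exact B.isS5.mono a c b b (B.isS5.le_of_rel a c hac) hcb le_rfl

/-- The identity morphism of `(B, S)` is `S`. -/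
def SubS5S.Hom.id (B : SubS5S.{u}) : SubS5S.Hom B B where
  rel := B.rel
  compat :=
    { toIsSubordination := B.isS5.toIsSubordination
      comp_right := B.comp_rel_self
      comp_left := B.comp_rel_self }

/-- Composition of morphisms is composition of relations. -/
def SubS5S.Hom.comp {B₁ B₂ B₃ : SubS5S.{u}} (T : SubS5S.Hom B₁ B₂) (U : SubS5S.Hom B₂ B₃) :
    SubS5S.Hom B₁ B₃ where
  rel := Relation.Comp T.rel U.rel
  compat :=
    { bot_bot := ⟨⊥, T.compat.bot_bot, U.compat.bot_bot⟩
      top_top := ⟨⊤, T.compat.top_top, U.compat.top_top⟩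
      sup_left := by
        rintro a b c ⟨x, hax, hxc⟩ ⟨y, hby, hyc⟩
        exact ⟨x ⊔ y, T.compat.sup_left _ _ _ (T.compat.mono _ _ _ _ le_rfl hax le_sup_left)
          (T.compat.mono _ _ _ _ le_rfl hby le_sup_right), U.compat.sup_left _ _ _ hxc hyc⟩
      inf_right := by
        rintro a c d ⟨x, hax, hxc⟩ ⟨y, hay, hyd⟩
        exact ⟨x ⊓ y, T.compat.inf_right _ _ _ hax hay, U.compat.inf_right _ _ _
          (U.compat.mono _ _ _ _ inf_le_left hxc le_rfl)
          (U.compat.mono _ _ _ _ inf_le_right hyd le_rfl)⟩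
      mono := by
        rintro a b c d hab ⟨x, hbx, hxc⟩ hcd
        exact ⟨x, T.compat.mono _ _ _ _ hab hbx le_rfl, U.compat.mono _ _ _ _ le_rfl hxc hcd⟩
      comp_right := by rw [Relation.comp_assoc, U.compat.comp_right]
      comp_left := by rw [← Relation.comp_assoc, T.compat.comp_left] }

/-- The category `SubS5^S` of S5-subordination algebras and compatible subordinations. -/
instance : Category.{u} SubS5S.{u} where
  Hom := SubS5S.Hom
  id := SubS5S.Hom.id
  comp := SubS5S.Hom.comp
  id_comp T := SubS5S.Hom.ext T.compat.comp_left
  comp_id T := SubS5S.Hom.ext T.compat.comp_right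
  assoc _ _ _ := SubS5S.Hom.ext Relation.comp_assoc

/-- De Vries algebras: S5-subordination algebras on a complete boolean algebra in which every
nonzero `a` has a nonzero `b` with `b S a`. -/
def IsDeVries : ObjectProperty SubS5S.{u} := fun B =>
  (∀ a : B.carrier, a ≠ ⊥ → ∃ b : B.carrier, b ≠ ⊥ ∧ B.rel b a) ∧
    ∀ s : Set B.carrier, ∃ x, IsLUB s x

/-- `DeV^S`, the full subcategory of `SubS5^S` of de Vries algebras. -/
abbrev DeVS : Type (u + 1) := IsDeVries.{u}.FullSubcategory

/-- The inclusion functor `Δ : DeV^S ⥤ SubS5^S`. -/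
abbrev Δ : DeVS.{u} ⥤ SubS5S.{u} := IsDeVries.ι

/-! Compact regular frames and preframe homomorphisms -/

/-- `a` is well-inside `b`; in a frame `aᶜ` is the pseudocomplement of `a`. -/
def WellInside {L : Type*} [Order.Frame L] (a b : L) : Prop := aᶜ ⊔ b = ⊤

/-- Compact regular frames: the objects of `KRFrm^P`. -/
structure KRFrmP : Type (u + 1) where
  carrier : Type u
  [frame : Order.Frame carrier]
  compact : IsCompactElement (⊤ : carrier)
  regular : ∀ a : carrier, a = sSup {x | WellInside x a}

attribute [instance] KRFrmP.frame

/-- Preframe homomorphisms: maps preserving finite meets and (nonempty) directed joins. -/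
@[ext]
structure PreframeHom (L M : Type*) [Order.Frame L] [Order.Frame M] where
  toFun : L → M
  map_top : toFun ⊤ = ⊤
  map_inf : ∀ a b, toFun (a ⊓ b) = toFun a ⊓ toFun b
  scott : ScottContinuous toFun

/-- The category `KRFrm^P` of compact regular frames and preframe homomorphisms. -/
instance : Category.{u} KRFrmP.{u} where
  Hom L M := PreframeHom L.carrier M.carrier
  id _ := ⟨fun a => a, rfl, fun _ _ => rfl, ScottContinuous.id⟩
  comp f g := ⟨fun a => g.toFun (f.toFun a), by rw [f.map_top, g.map_top],
    fun a b => by rw [f.map_inf, g.map_inf], f.scott.comp g.scott⟩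

/-! The functor of round ideals -/

/-- Round ideals of an S5-subordination algebra, ordered by inclusion. -/
def RoundIdeal (B : SubS5S.{u}) : Type u :=
  {I : Order.Ideal B.carrier // ∀ a ∈ I, ∃ b ∈ I, B.rel a b}

namespace RoundIdeal

variable {B : SubS5S.{u}}

instance : SetLike (RoundIdeal B) B.carrier where
  coe I := I.1
  coe_injective _ _ h := Subtype.ext (SetLike.coe_injective h)

instance : PartialOrder (RoundIdeal B) := PartialOrder.lift Subtype.val Subtype.val_injective

theorem le_def {I J : RoundIdeal B} : I ≤ J ↔ ∀ a ∈ I, a ∈ J := Iff.rfl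

theorem bot_mem (I : RoundIdeal B) : ⊥ ∈ I := I.1.bot_mem

theorem sup_mem (I : RoundIdeal B) {a b : B.carrier} (ha : a ∈ I) (hb : b ∈ I) : a ⊔ b ∈ I :=
  Order.Ideal.sup_mem (s := I.1) ha hb

theorem mem_of_le (I : RoundIdeal B) {a b : B.carrier} (h : a ≤ b) (hb : b ∈ I) : a ∈ I :=
  I.1.lower h hb

theorem round (I : RoundIdeal B) {a : B.carrier} (ha : a ∈ I) : ∃ b ∈ I, B.rel a b := I.2 a ha

theorem finset_sup_mem (I : RoundIdeal B) (t : Finset B.carrier) (h : ∀ x ∈ t, x ∈ I) :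
    t.sup id ∈ I :=
  Finset.sup_induction I.bot_mem (fun _ ha _ hb => I.sup_mem ha hb) h

/-- A round ideal from its set of elements. -/
def mk' (s : Set B.carrier) (bot : ⊥ ∈ s) (sup : ∀ a ∈ s, ∀ b ∈ s, a ⊔ b ∈ s)
    (lower : ∀ a b, a ≤ b → b ∈ s → a ∈ s) (round : ∀ a ∈ s, ∃ b ∈ s, B.rel a b) :
    RoundIdeal B :=
  ⟨{ carrier := s
     lower' := fun a b h ha => lower b a h ha
     nonempty' := ⟨⊥, bot⟩
     directed' := fun a ha b hb => ⟨a ⊔ b, sup a ha b hb, le_sup_left, le_sup_right⟩ }, round⟩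

/-- The join of round ideals is the ideal generated by their union. -/
instance : SupSet (RoundIdeal B) where
  sSup 𝒮 := mk'
    {a | ∃ t : Finset B.carrier, (∀ x ∈ t, ∃ I ∈ 𝒮, x ∈ I) ∧ a ≤ t.sup id}
    ⟨∅, by simp, bot_le⟩
    (by
      classical
      rintro a ⟨t, ht, hat⟩ b ⟨t', ht', hbt'⟩
      refine ⟨t ∪ t', fun x hx => ?_, ?_⟩
      · rcases Finset.mem_union.1 hx with hx | hx
        · exact ht x hx
        · exact ht' x hx
      · rw [Finset.sup_union]
        exact sup_le_sup hat hbt')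
    (by
      rintro a b hab ⟨t, ht, hbt⟩
      exact ⟨t, ht, hab.trans hbt⟩)
    (by
      classical
      rintro a ⟨t, ht, hat⟩
      have key : ∃ t' : Finset B.carrier, (∀ x ∈ t', ∃ I ∈ 𝒮, x ∈ I) ∧
          B.rel (t.sup id) (t'.sup id) := by
        clear hat
        induction t using Finset.induction_on with
        | empty => exact ⟨∅, by simp, B.isS5.bot_bot⟩
        | insert x t hx ih =>
          obtain ⟨t', ht', hr⟩ := ih fun y hy => ht y (Finset.mem_insert_of_mem hy)
          obtain ⟨I, hI, hxI⟩ := ht x (Finset.mem_insert_self x t)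
          obtain ⟨y, hyI, hxy⟩ := I.round hxI
          refine ⟨insert y t', fun z hz => ?_, ?_⟩
          · rcases Finset.mem_insert.1 hz with rfl | hz
            · exact ⟨I, hI, hyI⟩
            · exact ht' z hz
          · rw [Finset.sup_insert, Finset.sup_insert]
            exact B.isS5.sup_left _ _ _ (B.isS5.mono _ _ _ _ le_rfl hxy le_sup_left)
              (B.isS5.mono _ _ _ _ le_rfl hr le_sup_right)
      obtain ⟨t', ht', hr⟩ := key
      exact ⟨t'.sup id, ⟨t', ht', le_rfl⟩, B.isS5.mono _ _ _ _ hat hr le_rfl⟩)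

theorem mem_sSup {𝒮 : Set (RoundIdeal B)} {a : B.carrier} :
    a ∈ sSup 𝒮 ↔ ∃ t : Finset B.carrier, (∀ x ∈ t, ∃ I ∈ 𝒮, x ∈ I) ∧ a ≤ t.sup id := Iff.rfl

theorem isLUB_sSup (𝒮 : Set (RoundIdeal B)) : IsLUB 𝒮 (sSup 𝒮) := by
  constructor
  · intro I hI a ha
    exact mem_sSup.2 ⟨{a}, by simpa using ⟨I, hI, ha⟩, by simp⟩
  · rintro J hJ a ⟨t, ht, hat⟩
    refine J.mem_of_le hat (J.finset_sup_mem t fun x hx => ?_)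
    obtain ⟨I, hI, hxI⟩ := ht x hx
    exact hJ hI hxI

/-- Binary meets of round ideals are intersections. -/
instance : Min (RoundIdeal B) where
  min I J := mk' {a | a ∈ I ∧ a ∈ J} ⟨I.bot_mem, J.bot_mem⟩
    (fun _ ha _ hb => ⟨I.sup_mem ha.1 hb.1, J.sup_mem ha.2 hb.2⟩)
    (fun _ _ h hb => ⟨I.mem_of_le h hb.1, J.mem_of_le h hb.2⟩)
    (by
      rintro a ⟨haI, haJ⟩
      obtain ⟨b, hb, hab⟩ := I.round haI
      obtain ⟨c, hc, hac⟩ := J.round haJ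
      exact ⟨b ⊓ c, ⟨I.mem_of_le inf_le_left hb, J.mem_of_le inf_le_right hc⟩,
        B.isS5.inf_right _ _ _ hab hac⟩)

/-- The greatest round ideal is the whole algebra. -/
instance : Top (RoundIdeal B) where
  top := mk' Set.univ trivial (fun _ _ _ _ => trivial) (fun _ _ _ _ => trivial)
    (fun _ _ => ⟨⊤, trivial, B.isS5.mono _ _ _ _ le_top B.isS5.top_top le_rfl⟩)

instance : CompleteLattice (RoundIdeal B) :=
  { completeLatticeOfSup (RoundIdeal B) isLUB_sSup with
    top := ⊤
    le_top := fun _ _ _ => trivial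
    inf := fun I J => I ⊓ J
    inf_le_left := fun _ _ _ h => h.1
    inf_le_right := fun _ _ _ h => h.2
    le_inf := fun _ _ _ h h' _ ha => ⟨h ha, h' ha⟩ }

theorem mem_inf {I J : RoundIdeal B} {a : B.carrier} : a ∈ I ⊓ J ↔ a ∈ I ∧ a ∈ J := Iff.rfl

theorem mem_top (a : B.carrier) : a ∈ (⊤ : RoundIdeal B) := trivial

instance : Order.Frame (RoundIdeal B) :=
  Order.Frame.ofMinimalAxioms
    { inf_sSup_le_iSup_inf := by
        rintro I 𝒮 a ⟨haI, t, ht, hat⟩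
        have h : a = t.sup fun x => a ⊓ x := by
          rw [← Finset.sup_inf_distrib_left, eq_comm, inf_eq_left]
          exact hat
        rw [h]
        refine Finset.sup_induction (p := fun z => z ∈ ⨆ J ∈ 𝒮, I ⊓ J) (bot_mem _)
          (fun _ ha _ hb => sup_mem _ ha hb) fun x hx => ?_
        obtain ⟨J, hJ, hxJ⟩ := ht x hx
        exact (le_iSup₂ (f := fun J (_ : J ∈ 𝒮) => I ⊓ J) J hJ)
          ⟨I.mem_of_le inf_le_left haI, J.mem_of_le inf_le_right hxJ⟩ }

/-- In a nonempty directed family, the join is the union. -/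
theorem mem_of_isLUB {D : Set (RoundIdeal B)} (hne : D.Nonempty) (hD : DirectedOn (· ≤ ·) D)
    {J : RoundIdeal B} (hJ : IsLUB D J) {a : B.carrier} (ha : a ∈ J) : ∃ I ∈ D, a ∈ I := by
  have hU : J ≤ mk' {a | ∃ I ∈ D, a ∈ I} ⟨hne.some, hne.some_mem, bot_mem _⟩
      (by
        rintro a ⟨I, hI, haI⟩ b ⟨I', hI', hbI'⟩
        obtain ⟨K, hK, h1, h2⟩ := hD I hI I' hI'
        exact ⟨K, hK, K.sup_mem (h1 haI) (h2 hbI')⟩)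
      (by
        rintro a b h ⟨I, hI, hbI⟩
        exact ⟨I, hI, I.mem_of_le h hbI⟩)
      (by
        rintro a ⟨I, hI, haI⟩
        obtain ⟨b, hb, hab⟩ := I.round haI
        exact ⟨b, ⟨I, hI, hb⟩, hab⟩) :=
    hJ.2 fun I hI a ha => ⟨I, hI, ha⟩
  exact hU ha

theorem isCompactElement_top : IsCompactElement (⊤ : RoundIdeal B) := by
  intro D J hne hD hJ hle
  obtain ⟨I, hI, h⟩ := mem_of_isLUB hne hD hJ (hle (mem_top ⊤))
  exact ⟨I, hI, fun a _ => I.mem_of_le le_top h⟩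

/-- The round ideal of all `a` with `a S b`. -/
def below (b : B.carrier) : RoundIdeal B :=
  mk' {a | B.rel a b} (B.isS5.mono _ _ _ _ le_rfl B.isS5.bot_bot bot_le)
    (fun _ ha _ hb => B.isS5.sup_left _ _ _ ha hb)
    (fun _ _ h hb => B.isS5.mono _ _ _ _ h hb le_rfl)
    (fun a ha => by
      obtain ⟨c, hac, hcb⟩ := B.isS5.exists_between a b ha
      exact ⟨c, hcb, hac⟩)

theorem mem_below {a b : B.carrier} : a ∈ below b ↔ B.rel a b := Iff.rfl

theorem wellInside_below {I : RoundIdeal B} {b : B.carrier} (hb : b ∈ I) :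
    WellInside (below b) I := by
  obtain ⟨d, hd, hbd⟩ := I.round hb
  have hK : below bᶜ ≤ (below b)ᶜ := by
    rw [le_compl_iff_disjoint_right, disjoint_iff_inf_le]
    rintro x ⟨hx, hx'⟩
    have h : x ≤ bᶜ ⊓ b := le_inf (B.isS5.le_of_rel _ _ hx) (B.isS5.le_of_rel _ _ hx')
    rw [compl_inf_self] at h
    exact mem_of_le _ h (bot_mem _)
  have hmem : dᶜ ∈ (below b)ᶜ := hK (B.isS5.compl_rel _ _ hbd)
  refine top_le_iff.1 fun x _ => mem_of_le _ (b := dᶜ ⊔ d) (by simp) ?_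
  exact sup_mem _ ((le_sup_left : (below b)ᶜ ≤ _) hmem) ((le_sup_right : I ≤ _) hd)

theorem regular (I : RoundIdeal B) : I = sSup {J | WellInside J I} := by
  refine le_antisymm (fun a ha => ?_) (sSup_le fun J hJ => ?_)
  · obtain ⟨b, hb, hab⟩ := I.round ha
    exact (le_sSup (show below b ∈ {J | WellInside J I} from wellInside_below hb)) hab
  · calc J = J ⊓ (Jᶜ ⊔ I) := by rw [show Jᶜ ⊔ I = ⊤ from hJ, inf_top_eq]
      _ ≤ I := by rw [inf_sup_left, inf_compl_self, bot_sup_eq]; exact inf_le_right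

/-- The round ideal `T⁻¹[I]`. -/
def preimage {B₁ B₂ : SubS5S.{u}} (T : B₁ ⟶ B₂) (I : RoundIdeal B₂) : RoundIdeal B₁ :=
  mk' {a | ∃ b ∈ I, T.rel a b} ⟨⊥, I.bot_mem, T.compat.bot_bot⟩
    (by
      rintro a ⟨x, hx, hax⟩ b ⟨y, hy, hby⟩
      exact ⟨x ⊔ y, I.sup_mem hx hy,
        T.compat.sup_left _ _ _ (T.compat.mono _ _ _ _ le_rfl hax le_sup_left)
          (T.compat.mono _ _ _ _ le_rfl hby le_sup_right)⟩)
    (by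
      rintro a b h ⟨x, hx, hbx⟩
      exact ⟨x, hx, T.compat.mono _ _ _ _ h hbx le_rfl⟩)
    (by
      rintro a ⟨x, hx, hax⟩
      rw [← T.compat.comp_left] at hax
      obtain ⟨b, hab, hbx⟩ := hax
      exact ⟨b, ⟨x, hx, hbx⟩, hab⟩)

theorem mem_preimage {B₁ B₂ : SubS5S.{u}} {T : B₁ ⟶ B₂} {I : RoundIdeal B₂} {a : B₁.carrier} :
    a ∈ preimage T I ↔ ∃ b ∈ I, T.rel a b := Iff.rfl

/-- `T⁻¹[-]` as a preframe homomorphism. -/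
def preimageHom {B₁ B₂ : SubS5S.{u}} (T : B₁ ⟶ B₂) :
    PreframeHom (RoundIdeal B₂) (RoundIdeal B₁) where
  toFun := preimage T
  map_top := top_le_iff.1 fun _ _ =>
    ⟨⊤, mem_top _, T.compat.mono _ _ _ _ le_top T.compat.top_top le_rfl⟩
  map_inf I J := by
    refine le_antisymm ?_ ?_
    · rintro a ⟨x, ⟨hxI, hxJ⟩, hax⟩
      exact ⟨⟨x, hxI, hax⟩, ⟨x, hxJ, hax⟩⟩
    · rintro a ⟨⟨x, hx, hax⟩, ⟨y, hy, hay⟩⟩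
      exact ⟨x ⊓ y, ⟨I.mem_of_le inf_le_left hx, J.mem_of_le inf_le_right hy⟩,
        T.compat.inf_right _ _ _ hax hay⟩
  scott := by
    intro D hne hD J hJ
    constructor
    · rintro _ ⟨I, hI, rfl⟩ a ⟨x, hx, hax⟩
      exact ⟨x, hJ.1 hI hx, hax⟩
    · rintro K hK a ⟨x, hx, hax⟩
      obtain ⟨I, hI, hxI⟩ := mem_of_isLUB hne hD hJ hx
      exact hK ⟨I, hI, rfl⟩ ⟨x, hxI, hax⟩

end RoundIdeal

/-- The contravariant functor `RI : SubS5^S → KRFrm^P`, sending `B` to its frame of round ideals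
and `T` to `I ↦ T⁻¹[I]`. -/
def RI : SubS5S.{u}ᵒᵖ ⥤ KRFrmP.{u} where
  obj B :=
    { carrier := RoundIdeal B.unop
      compact := RoundIdeal.isCompactElement_top
      regular := RoundIdeal.regular }
  map T := RoundIdeal.preimageHom T.unop
  map_id B := by
    refine PreframeHom.ext (funext fun I => le_antisymm ?_ ?_)
    · rintro a ⟨b, hb, hab⟩
      exact RoundIdeal.mem_of_le I (B.unop.isS5.le_of_rel a b hab) hb
    · intro a ha
      exact RoundIdeal.round I ha
  map_comp T U := by
    refine PreframeHom.ext (funext fun I => le_antisymm ?_ ?_)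
    · rintro a ⟨c, hc, b, hab, hbc⟩
      exact ⟨b, ⟨c, hc, hbc⟩, hab⟩
    · rintro a ⟨b, ⟨c, hc, hbc⟩, hab⟩
      exact ⟨c, hc, b, hab, hbc⟩

/-! The booleanization functor -/

section WellInside

variable {L : Type*} [Order.Frame L]

theorem WellInside.le {a b : L} (h : WellInside a b) : a ≤ b :=
  calc a = a ⊓ (aᶜ ⊔ b) := by rw [show aᶜ ⊔ b = ⊤ from h, inf_top_eq]
    _ ≤ b := by rw [inf_sup_left, inf_compl_self, bot_sup_eq]; exact inf_le_right

theorem WellInside.mono {a b c d : L} (hab : a ≤ b) (h : WellInside b c) (hcd : c ≤ d) :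
    WellInside a d :=
  top_le_iff.1 ((show bᶜ ⊔ c = ⊤ from h) ▸ sup_le_sup (compl_le_compl hab) hcd)

theorem WellInside.sup {a b c : L} (ha : WellInside a c) (hb : WellInside b c) :
    WellInside (a ⊔ b) c := by
  unfold WellInside at *
  rw [compl_sup, sup_inf_right, ha, hb, inf_top_eq]

theorem WellInside.inf {a b c : L} (hb : WellInside a b) (hc : WellInside a c) :
    WellInside a (b ⊓ c) := by
  unfold WellInside at *
  rw [sup_inf_left, hb, hc, inf_top_eq]

theorem WellInside.compl_compl {a b : L} (h : WellInside a b) : WellInside aᶜᶜ b := by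
  unfold WellInside at *
  rwa [compl_compl_compl]

theorem wellInside_bot (b : L) : WellInside ⊥ b := by simp [WellInside]

theorem wellInside_top (a : L) : WellInside a ⊤ := by simp [WellInside]

/-- Compactness: `b ≺ ⋁ D` with `D` directed gives `b ≺ d` for some `d ∈ D`. -/
theorem WellInside.exists_of_isLUB (hL : IsCompactElement (⊤ : L)) {D : Set L}
    (hne : D.Nonempty) (hD : DirectedOn (· ≤ ·) D) {m b : L} (hm : IsLUB D m)
    (h : WellInside b m) : ∃ d ∈ D, WellInside b d := by
  obtain ⟨_, ⟨d, hd, rfl⟩, htop⟩ := hL ((fun d => bᶜ ⊔ d) '' D) ⊤ (hne.image _)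
    (by
      rintro _ ⟨x, hx, rfl⟩ _ ⟨y, hy, rfl⟩
      obtain ⟨z, hz, hxz, hyz⟩ := hD x hx y hy
      exact ⟨_, ⟨z, hz, rfl⟩, sup_le_sup_left hxz _, sup_le_sup_left hyz _⟩)
    (by
      refine ⟨fun _ _ => le_top, fun w hw => ?_⟩
      rw [← show bᶜ ⊔ m = ⊤ from h]
      obtain ⟨x, hx⟩ := hne
      exact sup_le (le_sup_left.trans (hw ⟨x, hx, rfl⟩))
        (hm.2 fun d hd => le_sup_right.trans (hw ⟨d, hd, rfl⟩)))
    le_rfl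
  exact ⟨d, hd, top_le_iff.1 htop⟩

end WellInside

namespace KRFrmP

variable (L : KRFrmP.{u})

/-- The regular elements well-inside `a`. -/
def approx (a : L.carrier) : Set L.carrier := {c | Heyting.IsRegular c ∧ WellInside c a}

theorem approx_nonempty (a : L.carrier) : (L.approx a).Nonempty :=
  ⟨⊥, Heyting.isRegular_bot, wellInside_bot a⟩

theorem approx_directed (a : L.carrier) : DirectedOn (· ≤ ·) (L.approx a) := by
  rintro x ⟨_, hx⟩ y ⟨_, hy⟩
  exact ⟨(x ⊔ y)ᶜᶜ, ⟨Heyting.isRegular_compl _, (hx.sup hy).compl_compl⟩,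
    le_sup_left.trans le_compl_compl, le_sup_right.trans le_compl_compl⟩

theorem isLUB_approx (a : L.carrier) : IsLUB (L.approx a) a := by
  refine ⟨fun c hc => hc.2.le, fun w hw => ?_⟩
  rw [L.regular a]
  exact sSup_le fun x hx =>
    le_compl_compl.trans (hw ⟨Heyting.isRegular_compl _, WellInside.compl_compl hx⟩)

theorem exists_between {a b : L.carrier} (h : WellInside a b) :
    ∃ c : Heyting.Regular L.carrier, WellInside a c ∧ WellInside (c : L.carrier) b := by
  obtain ⟨c, ⟨hc, hcb⟩, hac⟩ :=
    h.exists_of_isLUB L.compact (L.approx_nonempty b) (L.approx_directed b) (L.isLUB_approx b)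
  exact ⟨⟨c, hc⟩, hac, hcb⟩

theorem exists_map {L M : KRFrmP.{u}} (f : L ⟶ M) {a : L.carrier} {b : M.carrier}
    (h : WellInside b (f.toFun a)) :
    ∃ c : Heyting.Regular L.carrier, WellInside (c : L.carrier) a ∧
      WellInside b (f.toFun c) := by
  obtain ⟨_, ⟨c, ⟨hc, hca⟩, rfl⟩, hbc⟩ :=
    h.exists_of_isLUB M.compact ((L.approx_nonempty a).image _)
      (by
        rintro _ ⟨x, hx, rfl⟩ _ ⟨y, hy, rfl⟩
        obtain ⟨z, hz, hxz, hyz⟩ := L.approx_directed a x hx y hy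
        exact ⟨_, ⟨z, hz, rfl⟩, f.scott.monotone hxz, f.scott.monotone hyz⟩)
      (f.scott (L.approx_nonempty a) (L.approx_directed a) (L.isLUB_approx a))
  exact ⟨⟨c, hc⟩, hca, hbc⟩

/-- The booleanization `{a | a = a**}` of a compact regular frame, with the restriction of the
well-inside relation. -/
def booleanization : SubS5S.{u} where
  carrier := Heyting.Regular L.carrier
  rel a b := WellInside (a : L.carrier) (b : L.carrier)
  isS5 :=
    { bot_bot := wellInside_bot _
      top_top := wellInside_top _
      sup_left := fun a b c ha hb => by
        rw [Heyting.Regular.coe_sup]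
        exact (WellInside.sup ha hb).compl_compl
      inf_right := fun _ (c : Heyting.Regular L.carrier) d hc hd => by
        change WellInside _ ((c ⊓ d : Heyting.Regular L.carrier) : L.carrier)
        rw [Heyting.Regular.coe_inf]
        exact WellInside.inf hc hd
      mono := fun a b c d hab h hcd => WellInside.mono hab h hcd
      le_of_rel := fun a b h => WellInside.le h
      compl_rel := fun a b h => by
        unfold WellInside at *
        rw [Heyting.Regular.coe_compl, Heyting.Regular.coe_compl, b.prop.eq, sup_comm]
        exact h
      exists_between := fun a b h => L.exists_between h }

theorem isDeVries_booleanization : IsDeVries L.booleanization := by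
  constructor
  · intro (a : Heyting.Regular L.carrier) ha
    by_contra! hcon
    refine ha (Heyting.Regular.coe_injective (le_bot_iff.1 ?_))
    refine (L.isLUB_approx (a : L.carrier)).2 fun c hc => ?_
    by_contra hne
    refine hcon (⟨c, hc.1⟩ : Heyting.Regular L.carrier) (fun h => hne ?_) hc.2
    exact (congrArg Heyting.Regular.val h).le
  · intro (s : Set (Heyting.Regular L.carrier))
    refine ⟨Heyting.Regular.toRegular (sSup (Heyting.Regular.val '' s)), ?_, ?_⟩
    · intro a ha
      exact (le_sSup (Set.mem_image_of_mem _ ha)).trans le_compl_compl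
    · intro (w : Heyting.Regular L.carrier) hw
      have h : sSup (Heyting.Regular.val '' s) ≤ (w : L.carrier) := by
        refine sSup_le ?_
        rintro _ ⟨a, ha, rfl⟩
        exact hw ha
      exact (compl_le_compl (compl_le_compl h)).trans w.prop.eq.le

end KRFrmP

/-- The compatible subordination `b ≺ □ a` between booleanizations. -/
def booleanizationHom {L M : KRFrmP.{u}} (f : L ⟶ M) :
    SubS5S.Hom M.booleanization L.booleanization where
  rel := fun (b : Heyting.Regular M.carrier) (a : Heyting.Regular L.carrier) =>
    WellInside (b : M.carrier) (f.toFun (a : L.carrier))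
  compat :=
    { bot_bot := wellInside_bot _
      top_top := by
        change WellInside (⊤ : M.carrier) (f.toFun ⊤)
        rw [f.map_top]
        exact wellInside_top _
      sup_left := fun (a : Heyting.Regular M.carrier) (b : Heyting.Regular M.carrier) c ha hb => by
        change WellInside ((a ⊔ b : Heyting.Regular M.carrier) : M.carrier) _
        rw [Heyting.Regular.coe_sup]
        exact (WellInside.sup ha hb).compl_compl
      inf_right := fun a (c : Heyting.Regular L.carrier) (d : Heyting.Regular L.carrier) hc hd => by
        change WellInside _ (f.toFun ((c ⊓ d : Heyting.Regular L.carrier) : L.carrier))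
        rw [Heyting.Regular.coe_inf, f.map_inf]
        exact WellInside.inf hc hd
      mono := fun a b c d hab h hcd => WellInside.mono hab h (f.scott.monotone hcd)
      comp_right := by
        funext b a
        refine propext ⟨?_, fun h => ?_⟩
        · rintro ⟨c, hbc, hca⟩
          exact WellInside.mono le_rfl hbc (f.scott.monotone (WellInside.le hca))
        · obtain ⟨c, hca, hbc⟩ := KRFrmP.exists_map f h
          exact ⟨c, hbc, hca⟩
      comp_left := by
        funext b a
        refine propext ⟨?_, fun h => M.exists_between h⟩
        rintro ⟨c, hbc, hca⟩
        exact WellInside.mono (WellInside.le hbc) hca le_rfl }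

/-- The contravariant functor `𝔅 : KRFrm^P → DeV^S`, sending `L` to its booleanization with the
well-inside relation and `□ : L → M` to the relation `b 𝔅(□) a ↔ b ≺ □ a`. -/
def 𝔅 : KRFrmP.{u}ᵒᵖ ⥤ DeVS.{u} where
  obj L := ⟨L.unop.booleanization, L.unop.isDeVries_booleanization⟩
  map f := ObjectProperty.homMk (booleanizationHom f.unop)
  map_id L := rfl
  map_comp f g := by
    refine ObjectProperty.hom_ext _ (SubS5S.Hom.ext ?_)
    funext c a
    refine propext ⟨fun h => ?_, ?_⟩
    · obtain ⟨b, hb, hcb⟩ := KRFrmP.exists_map f.unop h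
      exact ⟨b, hcb, hb⟩
    · rintro ⟨b, hcb, hba⟩
      exact WellInside.mono le_rfl hcb (f.unop.scott.monotone (WellInside.le hba))

/-- The MacNeille completion functor `NI = 𝔅 ∘ RI : SubS5^S ⥤ DeV^S`. -/
def NI : SubS5S.{u} ⥤ DeVS.{u} := RI.rightOp ⋙ 𝔅

end S5Sub

open CategoryTheory S5Sub

/-!
Everything rests on two interpolation properties of round ideals. A round ideal `I` is the directed
join of the ideals `below b` with `b ∈ I`, and each of these is well-inside `I`. Hence `a ∈ I` iff
`a ∈ J ≺ I` for some regular `J`, and, by compactness, `J ≺ I` iff `J ≺ below b` for some `b ∈ I`.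
Read as equations between composites of relations, these say that `a ∈ J` and `J ≺ below b` are
mutually inverse morphisms between `B` and `𝔅 (RI B)`.

Dually, an element `a` of a compact regular frame `L` is the directed join of the regular elements
well-inside it, and these form a round ideal of `𝔅 L`; by compactness every round ideal of `𝔅 L`
arises in this way from its join in `L`, so `L` is isomorphic to `RI (𝔅 L)`.

The statements about `DeV^S` follow because `Δ` is fully faithful.
-/

namespace S5Sub

theorem SubS5S.hom_ext {B₁ B₂ : SubS5S.{u}} {T U : B₁ ⟶ B₂}
    (h : ∀ a b, T.rel a b ↔ U.rel a b) : T = U :=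
  SubS5S.Hom.ext (funext₂ fun a b => propext (h a b))

section WellInside

variable {L : Type*} [Order.Frame L]

theorem WellInside.trans {a b c : L} (hab : WellInside a b) (hbc : WellInside b c) :
    WellInside a c :=
  WellInside.mono hab.le hbc le_rfl

theorem WellInside.regular_sup {a b : Heyting.Regular L} {c : L}
    (ha : WellInside (a : L) c) (hb : WellInside (b : L) c) :
    WellInside ((a ⊔ b : Heyting.Regular L) : L) c := by
  rw [Heyting.Regular.coe_sup]
  exact (ha.sup hb).compl_compl

end WellInside

namespace KRFrmP

theorem wellInside_iff_exists_between {L : KRFrmP.{u}} {a b : L.carrier} :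
    WellInside a b ↔
      ∃ c : Heyting.Regular L.carrier, WellInside a c ∧ WellInside (c : L.carrier) b :=
  ⟨L.exists_between, fun ⟨_, hac, hcb⟩ => hac.trans hcb⟩

theorem wellInside_map_iff {L M : KRFrmP.{u}} (f : L ⟶ M) {a : L.carrier} {b : M.carrier} :
    WellInside b (f.toFun a) ↔
      ∃ c : Heyting.Regular L.carrier, WellInside (c : L.carrier) a ∧ WellInside b (f.toFun c) :=
  ⟨exists_map f, fun ⟨_, hca, hbc⟩ => WellInside.mono le_rfl hbc (f.scott.monotone hca.le)⟩

end KRFrmP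

namespace RoundIdeal

variable {B : SubS5S.{u}}

theorem mem_iff_exists_rel {I : RoundIdeal B} {a : B.carrier} :
    a ∈ I ↔ ∃ b, B.rel a b ∧ b ∈ I :=
  ⟨fun ha => (I.round ha).imp fun _ => And.symm,
    fun ⟨b, hab, hb⟩ => I.mem_of_le (B.isS5.le_of_rel a b hab) hb⟩

theorem below_le {I : RoundIdeal B} {b : B.carrier} (hb : b ∈ I) : below b ≤ I :=
  fun _ hab => mem_iff_exists_rel.2 ⟨b, hab, hb⟩

theorem below_mono : Monotone (below : B.carrier → RoundIdeal B) :=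
  fun _ _ hbc a hab => B.isS5.mono a _ _ _ le_rfl hab hbc

theorem below_top : below (⊤ : B.carrier) = ⊤ :=
  top_le_iff.1 fun a _ => B.isS5.mono a _ _ _ le_top B.isS5.top_top le_rfl

theorem below_inf_below_le (b c : B.carrier) : below b ⊓ below c ≤ below (b ⊓ c) :=
  fun _ ⟨hab, hac⟩ => B.isS5.inf_right _ _ _ hab hac

theorem isLUB_image_below (I : RoundIdeal B) : IsLUB (below '' (I : Set B.carrier)) I := by
  refine ⟨?_, fun J hJ a ha => ?_⟩
  · rintro _ ⟨b, hb, rfl⟩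
    exact below_le hb
  · obtain ⟨b, hb, hab⟩ := I.round ha
    exact hJ ⟨b, hb, rfl⟩ hab

theorem directedOn_image_below (I : RoundIdeal B) :
    DirectedOn (· ≤ ·) (below '' (I : Set B.carrier)) :=
  I.1.directed.mono_comp below_mono

theorem wellInside_iff_exists_below {J I : RoundIdeal B} :
    WellInside J I ↔ ∃ b, WellInside J (below b) ∧ b ∈ I := by
  refine ⟨fun h => ?_, fun ⟨b, hJb, hb⟩ => WellInside.mono le_rfl hJb (below_le hb)⟩
  obtain ⟨_, ⟨b, hb, rfl⟩, hJb⟩ := h.exists_of_isLUB isCompactElement_top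
    (Set.Nonempty.image _ ⟨⊥, I.bot_mem⟩) I.directedOn_image_below I.isLUB_image_below
  exact ⟨b, hJb, hb⟩

theorem mem_iff_exists_regular {I : RoundIdeal B} {a : B.carrier} :
    a ∈ I ↔ ∃ J : Heyting.Regular (RoundIdeal B),
      a ∈ (J : RoundIdeal B) ∧ WellInside (J : RoundIdeal B) I := by
  refine ⟨fun ha => ?_, fun ⟨J, haJ, hJI⟩ => hJI.le haJ⟩
  obtain ⟨b, hb, hab⟩ := I.round ha
  exact ⟨⟨(below b)ᶜᶜ, Heyting.isRegular_compl _⟩,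
    (le_compl_compl : below b ≤ _) hab, (wellInside_below hb).compl_compl⟩

/-- The morphism `a ∈ J` from `B` to its MacNeille completion, whose elements are the regular round
ideals `J` of `B`. -/
def memHom (B : SubS5S.{u}) : B ⟶ (NI.obj B).obj where
  rel a (J : Heyting.Regular (RoundIdeal B)) := a ∈ (J : RoundIdeal B)
  compat :=
    { bot_bot := bot_mem _
      top_top := mem_top _
      sup_left := fun _ _ J ha hb => sup_mem (Heyting.Regular.val J) ha hb
      inf_right := fun _ _ _ hJ hK => ⟨hJ, hK⟩
      mono := fun _ _ J _ hab hb hJK =>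
        (show Heyting.Regular.val J ≤ _ from hJK) (mem_of_le _ hab hb)
      comp_right := funext₂ fun _ _ => propext mem_iff_exists_regular.symm
      comp_left := funext₂ fun _ _ => propext mem_iff_exists_rel.symm }

/-- The morphism `J ≺ below b` from the MacNeille completion of `B` to `B`, inverse to `memHom`. -/
def belowHom (B : SubS5S.{u}) : (NI.obj B).obj ⟶ B where
  rel (J : Heyting.Regular (RoundIdeal B)) b := WellInside (J : RoundIdeal B) (below b)
  compat :=
    { bot_bot := wellInside_bot _
      top_top := below_top (B := B) ▸ wellInside_top _
      sup_left := fun _ _ _ hJ hK => WellInside.regular_sup hJ hK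
      inf_right := fun _ b c hb hc =>
        WellInside.mono le_rfl (WellInside.inf hb hc) (below_inf_below_le b c)
      mono := fun _ _ _ _ hJK hb hbc => WellInside.mono hJK hb (below_mono hbc)
      comp_right := funext₂ fun _ _ => propext (wellInside_iff_exists_below (I := below _)).symm
      comp_left := funext₂ fun _ _ =>
        propext (KRFrmP.wellInside_iff_exists_between (L := RI.obj (.op B))).symm }

/-- Every S5-subordination algebra is isomorphic in `SubS5^S` to its MacNeille completion. -/
def isoNI (B : SubS5S.{u}) : B ≅ (NI.obj B).obj where
  hom := memHom B
  inv := belowHom B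
  hom_inv_id := SubS5S.hom_ext fun _ b => (mem_iff_exists_regular (I := below b)).symm
  inv_hom_id := SubS5S.hom_ext fun _ _ => wellInside_iff_exists_below.symm

theorem isoNI_hom_naturality {B₁ B₂ : SubS5S.{u}} (T : B₁ ⟶ B₂) :
    T ≫ (isoNI B₂).hom = (isoNI B₁).hom ≫ (NI.map T).hom :=
  SubS5S.hom_ext fun a (K : Heyting.Regular (RoundIdeal B₂)) =>
    calc (∃ b, T.rel a b ∧ b ∈ (K : RoundIdeal B₂)) ↔ a ∈ preimage T K :=
          exists_congr fun _ => and_comm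
      _ ↔ ∃ J : Heyting.Regular (RoundIdeal B₁),
            a ∈ (J : RoundIdeal B₁) ∧ WellInside (J : RoundIdeal B₁) (preimage T K) :=
          mem_iff_exists_regular

end RoundIdeal

/-- An order isomorphism between frames, as a preframe homomorphism. -/
def PreframeHom.ofOrderIso {L M : Type*} [Order.Frame L] [Order.Frame M] (e : L ≃o M) :
    PreframeHom L M where
  toFun := e
  map_top := e.map_top
  map_inf := e.map_inf
  scott _ _ _ _ h := e.isLUB_image'.2 h

namespace KRFrmP

/-- An order isomorphism between compact regular frames, as an isomorphism of `KRFrm^P`. -/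
def isoOfOrderIso {L M : KRFrmP.{u}} (e : L.carrier ≃o M.carrier) : L ≅ M where
  hom := PreframeHom.ofOrderIso e
  inv := PreframeHom.ofOrderIso e.symm
  hom_inv_id := PreframeHom.ext (funext e.symm_apply_apply)
  inv_hom_id := PreframeHom.ext (funext e.apply_symm_apply)

variable (L : KRFrmP.{u})

/-- The round ideal of `𝔅 L` consisting of the regular elements well-inside `a`. -/
def approxIdeal (a : L.carrier) : RoundIdeal L.booleanization :=
  .mk' {c : Heyting.Regular L.carrier | WellInside (c : L.carrier) a} (wellInside_bot a)
    (fun _ hb _ hc => WellInside.regular_sup hb hc)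
    (fun _ _ hbc hc => WellInside.mono hbc hc le_rfl)
    (fun _ hb => (L.exists_between hb).imp fun _ => And.symm)

theorem approxIdeal_le_approxIdeal {a b : L.carrier} :
    L.approxIdeal a ≤ L.approxIdeal b ↔ a ≤ b := by
  refine ⟨fun h => (L.isLUB_approx a).2 fun c ⟨hc, hca⟩ => ?_,
    fun hab _ hc => WellInside.mono le_rfl hc hab⟩
  have hcb : (⟨c, hc⟩ : Heyting.Regular L.carrier) ∈ L.approxIdeal b := h hca
  exact WellInside.le hcb

/-- The join in `L` of a round ideal of `𝔅 L`. -/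
def idealJoin (I : RoundIdeal L.booleanization) : L.carrier :=
  sSup (Heyting.Regular.val '' (I : Set L.booleanization.carrier))

theorem wellInside_idealJoin_iff {I : RoundIdeal L.booleanization} {a : L.carrier} :
    WellInside a (L.idealJoin I) ↔
      ∃ c : Heyting.Regular L.carrier, WellInside a (c : L.carrier) ∧ c ∈ I := by
  refine ⟨fun h => ?_, fun ⟨c, hac, hc⟩ => WellInside.mono le_rfl hac (le_sSup ⟨c, hc, rfl⟩)⟩
  have hdir : DirectedOn (· ≤ ·) (Heyting.Regular.val '' (I : Set L.booleanization.carrier)) :=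
    I.1.directed.mono_comp fun _ _ hbc => hbc
  obtain ⟨_, ⟨c, hc, rfl⟩, hac⟩ :=
    h.exists_of_isLUB L.compact (Set.Nonempty.image _ ⟨⊥, I.bot_mem⟩) hdir (isLUB_sSup _)
  exact ⟨c, hac, hc⟩

theorem approxIdeal_idealJoin (I : RoundIdeal L.booleanization) :
    L.approxIdeal (L.idealJoin I) = I :=
  SetLike.ext fun b =>
    calc WellInside (Heyting.Regular.val b) (L.idealJoin I) ↔
          ∃ c, L.booleanization.rel b c ∧ c ∈ I := L.wellInside_idealJoin_iff
      _ ↔ b ∈ I := RoundIdeal.mem_iff_exists_rel.symm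

/-- A compact regular frame is isomorphic to the frame of round ideals of its booleanization. -/
noncomputable def orderIsoRoundIdeal : L.carrier ≃o RoundIdeal L.booleanization :=
  RelIso.ofSurjective
    (OrderEmbedding.ofMapLEIff L.approxIdeal fun _ _ => L.approxIdeal_le_approxIdeal)
    fun I => ⟨L.idealJoin I, L.approxIdeal_idealJoin I⟩

theorem approxIdeal_map {L M : KRFrmP.{u}} (f : L ⟶ M) (a : L.carrier) :
    M.approxIdeal (f.toFun a) = RoundIdeal.preimage (booleanizationHom f) (L.approxIdeal a) :=
  SetLike.ext fun _ => wellInside_map_iff f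

end KRFrmP

/-- The unit `1 ≅ Δ ∘ NI` of the equivalence between `SubS5^S` and `DeV^S`. -/
def macNeilleUnitIso : 𝟭 SubS5S.{u} ≅ NI ⋙ Δ :=
  NatIso.ofComponents RoundIdeal.isoNI RoundIdeal.isoNI_hom_naturality

/-- The counit `NI ∘ Δ ≅ 1` of the equivalence between `SubS5^S` and `DeV^S`. -/
noncomputable def macNeilleCounitIso : Δ.{u} ⋙ NI ≅ 𝟭 DeVS.{u} :=
  Functor.fullyFaithfulCancelRight Δ (Functor.isoWhiskerLeft Δ macNeilleUnitIso.symm)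

/-- The natural isomorphism `L ≅ RI (𝔅 L)` on `KRFrm^P`. -/
noncomputable def roundIdealIso : 𝟭 KRFrmP.{u} ≅ 𝔅.rightOp ⋙ Δ.op ⋙ RI :=
  NatIso.ofComponents (fun L => KRFrmP.isoOfOrderIso L.orderIsoRoundIdeal)
    fun f => PreframeHom.ext (funext (KRFrmP.approxIdeal_map f))

/-- The dual equivalence between `SubS5^S` and `KRFrm^P` given by `RI` and `Δ ∘ 𝔅`. -/
noncomputable def subS5SEquivalence : SubS5S.{u}ᵒᵖ ≌ KRFrmP.{u} :=
  .mk RI (𝔅 ⋙ Δ).rightOp (NatIso.op macNeilleUnitIso.symm) roundIdealIso.symm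

/-- The dual equivalence between `DeV^S` and `KRFrm^P` given by `RI ∘ Δ` and `𝔅`. -/
noncomputable def deVSEquivalence : DeVS.{u}ᵒᵖ ≌ KRFrmP.{u} :=
  .mk (Δ.op ⋙ RI) 𝔅.rightOp (NatIso.op macNeilleCounitIso) roundIdealIso.symm

/-- The equivalence between `SubS5^S` and `DeV^S` given by `NI` and `Δ`. -/
noncomputable def macNeilleEquivalence : SubS5S.{u} ≌ DeVS.{u} :=
  .mk NI Δ macNeilleUnitIso macNeilleCounitIso

end S5Sub

theorem mainTheorem2 :
    (∃ e : SubS5S.{u}ᵒᵖ ≌ KRFrmP.{u},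
      e.functor = RI ∧ e.inverse = (𝔅 ⋙ Δ).rightOp) ∧
    (∃ e : DeVS.{u}ᵒᵖ ≌ KRFrmP.{u},
      e.functor = Δ.op ⋙ RI ∧ e.inverse = 𝔅.rightOp) ∧
    (∃ e : SubS5S.{u} ≌ DeVS.{u}, e.functor = NI ∧ e.inverse = Δ) ∧
    Nonempty (RI.{u}.rightOp ⋙ 𝔅 ≅ NI) ∧
    Nonempty (RI.{u}.rightOp ⋙ 𝔅 ⋙ Δ ≅ 𝟭 SubS5S.{u}) ∧
    Nonempty (Δ.{u} ⋙ RI.rightOp ⋙ 𝔅 ≅ 𝟭 DeVS.{u}) ∧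
    Nonempty (𝔅.{u}.rightOp ⋙ Δ.op ⋙ RI ≅ 𝟭 KRFrmP.{u}) ∧
    Nonempty (Δ.{u}.op ⋙ RI ⋙ 𝔅.rightOp ≅ 𝟭 DeVS.{u}ᵒᵖ) ∧
    Nonempty (NI.{u} ⋙ Δ ≅ 𝟭 SubS5S.{u}) ∧
    Nonempty (Δ.{u} ⋙ NI ≅ 𝟭 DeVS.{u}) := by
  exact ⟨⟨subS5SEquivalence, rfl, rfl⟩,
    ⟨deVSEquivalence, rfl, rfl⟩,
    ⟨macNeilleEquivalence, rfl, rfl⟩,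
    ⟨Iso.refl _⟩,
    ⟨macNeilleUnitIso.symm⟩,
    ⟨macNeilleCounitIso⟩,
    ⟨roundIdealIso.symm⟩,
    ⟨deVSEquivalence.unitIso.symm⟩,
    ⟨macNeilleUnitIso.symm⟩,
    ⟨macNeilleCounitIso⟩⟩
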